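/- Let $A>1$. There is a constant $c>0$, depending only on $A$, such that the following holds for all integers $d\ge 1$, $M\ge 2$, all real $q>0$ and all integers $n\ge 0$ with $\log M\le 16\,(\min(1,A-1))^2\,n$. Let $\mathcal F(A)$ be the set of all probability densities $f$ on $\mathbb R^d$ (with respect to Lebesgue measure $\lambda$) with $0\le f\le A$. For densities $f,g$ on $\mathbb R^d$ let $P_f=f\,d\lambda$, and let $K(f|g)=\int \log(f/g)\,f\,d\lambda\in[0,\infty]$ if $P_f\ll P_g$ and $K(f|g)=+\infty$ otherwise. An estimator $\hat f_n$ based on a sample of size $n$ assigns to each $(x_1,\dots,x_n)\in(\mathbb R^d)^n$ a density on $\mathbb R^d$, jointly measurably in $(x_1,\dots,x_n)$ and the point of evaluation; $\mathbb E_f$ denotes expectation when the sample consists of $n$ i.i.d. observations of density $f$. Then $$\sup_{f_1,\ldots,f_M\in\mathcal F(A)}\ \inf_{\hat f_n}\ \sup_{f\in\mathcal F(A)}\Big[\mathbb E_f\big[K(f|\hat f_n)^q\big]-\min_{j=1,\ldots,M}K(f|f_j)^q\Big]\ \ge\ c\Big(\frac{\log M}{n}\Big)^q$$ and $$\sup_{f_1,\ldots,f_M\in\mathcal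 F(A)}\ \inf_{\hat f_n}\ \sup_{f\in\mathcal F(A)}\Big[\mathbb E_f\big[K(\hat f_n|f)^q\big]-\min_{j=1,\ldots,M}K(f_j|f)^q\Big]\ \ge\ c\Big(\frac{\log M}{n}\Big)^q .$$ Here the infimum is over all estimators based on a sample of size $n$, all quantities are taken in $[-\infty,+\infty]$, and the difference in brackets is read as $-\infty$ when the minimum is infinite. -/

import Mathlib

open MeasureTheory InformationTheory
open scoped ENNReal

namespace DensityAggregation

/-- `f` is a probability density on `ℝ^d` with respect to Lebesgue measure. -/
structure IsDensity {d : ℕ} (f : EuclideanSpace ℝ (Fin d) → ℝ) : Prop where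
  measurable : Measurable f
  nonneg : ∀ x, 0 ≤ f x
  lintegral_eq_one : ∫⁻ x, ENNReal.ofReal (f x) = 1

/-- The probability distribution `P_f` of density `f` with respect to Lebesgue measure. -/
noncomputable def law {d : ℕ} (f : EuclideanSpace ℝ (Fin d) → ℝ) :
    Measure (EuclideanSpace ℝ (Fin d)) :=
  (volume : Measure (EuclideanSpace ℝ (Fin d))).withDensity fun x => ENNReal.ofReal (f x)

/-- The Kullback-Leibler divergence `K(f|g)`: it is `∫ log (f / g) f` if `P_f ≪ P_g`
(and `∞` if that integral is infinite), and `∞` if `P_f` is not absolutely continuous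
with respect to `P_g`. -/
noncomputable def KL {d : ℕ} (f g : EuclideanSpace ℝ (Fin d) → ℝ) : ℝ≥0∞ :=
  klDiv (law f) (law g)

/-- The set of all densities on `ℝ^d` that are bounded by `A`. -/
def boundedDensities (d : ℕ) (A : ℝ) : Set (EuclideanSpace ℝ (Fin d) → ℝ) :=
  {f | IsDensity f ∧ ∀ x, f x ≤ A}

/-- A density estimator based on a sample of size `n`: a density for every value of the sample,
jointly measurable in the sample and the point of evaluation. -/
structure IsEstimator {d : ℕ} (n : ℕ)
    (fhat : (Fin n → EuclideanSpace ℝ (Fin d)) → EuclideanSpace ℝ (Fin d) → ℝ) : Prop where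
  measurable : Measurable (Function.uncurry fhat)
  isDensity : ∀ D, IsDensity (fhat D)

/-- The set of all density estimators on `ℝ^d` based on a sample of size `n`. -/
def estimators (d n : ℕ) :
    Set ((Fin n → EuclideanSpace ℝ (Fin d)) → EuclideanSpace ℝ (Fin d) → ℝ) :=
  {fhat | IsEstimator n fhat}

/-- The expectation `E_f` of a nonnegative function of a sample of `n` i.i.d. observations
of density `f`. -/
noncomputable def expect {d n : ℕ} (f : EuclideanSpace ℝ (Fin d) → ℝ)
    (Z : (Fin n → EuclideanSpace ℝ (Fin d)) → ℝ≥0∞) : ℝ≥0∞ :=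
  ∫⁻ D, Z D ∂(Measure.pi fun _ : Fin n => law f)

/-- The excess risk `E_f[loss(f, fhat)] - min_j loss(f, f_j)` in the extended reals.
If the minimum is infinite, the difference is `-∞` (in particular `∞ - ∞ = -∞`), so that such
an `f` never contributes to a supremum of excess risks. -/
noncomputable def excessRisk {d n M : ℕ}
    (loss : (EuclideanSpace ℝ (Fin d) → ℝ) → (EuclideanSpace ℝ (Fin d) → ℝ) → ℝ≥0∞)
    (fs : Fin M → EuclideanSpace ℝ (Fin d) → ℝ)
    (fhat : (Fin n → EuclideanSpace ℝ (Fin d)) → EuclideanSpace ℝ (Fin d) → ℝ)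
    (f : EuclideanSpace ℝ (Fin d) → ℝ) : EReal :=
  (expect f (fun D => loss f (fhat D)) : EReal) - ((⨅ j, loss f (fs j) : ℝ≥0∞) : EReal)

/-- The value `sup_{f_1, …, f_M} inf_{fhat} sup_f` of the excess risk, where `f_1, …, f_M` and `f`
range over the densities bounded by `A`, and `fhat` over the estimators based on a sample
of size `n`. -/
noncomputable def minimaxExcess (d n M : ℕ) (A : ℝ)
    (loss : (EuclideanSpace ℝ (Fin d) → ℝ) → (EuclideanSpace ℝ (Fin d) → ℝ) → ℝ≥0∞) : EReal :=
  ⨆ fs : Fin M → boundedDensities d A, ⨅ fhat : estimators d n, ⨆ f : boundedDensities d A,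
    excessRisk loss (fun j => (fs j).1) fhat.1 f.1

end DensityAggregation

/-!
All the densities are mixtures of uniform distributions on disjoint cells, one of which is common.

For `K(f|fhat)`, let `f` have mass `1 / (2 * n)` on one of many cells and the rest on the common
cell. With probability at least `1 / 2` the whole sample lies in the common cell and carries no
information on the spike, while no prediction can give all the other cells more than their fair
share of the mass. The candidates spread the spike over one of `M` blocks of cells, and the
candidate of the right block loses less than the estimator.

For `K(fhat|f)`, the candidates arise from one mixture by deleting one of `M` cells. A prediction
that charges a deleted cell has infinite loss. Hence, having seen a sample, the prediction must
avoid all the cells which the sample has not visited, for any of them might be the deleted one.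
If the common cell has mass `x ^ 2`, where `-log x = log M / n`, the visited cells typically carry
mass at most `x` under the true density, and a prediction concentrated on a set of mass at most
`x` has divergence at least `-log x`.
-/

namespace DensityAggregation

open Function ProbabilityTheory
open scoped Finset

section StepFun

variable {α ι : Type*} [Fintype ι] {E : ι → Set α} {a : ι → ℝ} {x : α}

/-- The function equal to `a i` on the set `E i`, for pairwise disjoint sets `E i`, and to `0`
off all of them. -/
noncomputable def stepFun (E : ι → Set α) (a : ι → ℝ) (x : α) : ℝ :=
  ∑ i, (E i).indicator (fun _ => a i) x

theorem stepFun_of_mem (hE : Pairwise (Disjoint on E)) {i : ι} (hx : x ∈ E i) :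
    stepFun E a x = a i := by
  rw [stepFun, Fintype.sum_eq_single i fun j hji =>
    Set.indicator_of_notMem (Set.disjoint_left.1 (hE hji.symm) hx) _, Set.indicator_of_mem hx]

theorem stepFun_of_notMem (hx : ∀ i, x ∉ E i) : stepFun E a x = 0 :=
  Finset.sum_eq_zero fun i _ => Set.indicator_of_notMem (hx i) _

theorem stepFun_nonneg (ha : ∀ i, 0 ≤ a i) (x : α) : 0 ≤ stepFun E a x :=
  Finset.sum_nonneg fun i _ => Set.indicator_nonneg (fun _ _ => ha i) x

theorem comp_stepFun (hE : Pairwise (Disjoint on E)) {g : ℝ → ℝ} (hg : g 0 = 0) (x : α) :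
    g (stepFun E a x) = stepFun E (g ∘ a) x := by
  by_cases hx : ∃ i, x ∈ E i
  · obtain ⟨i, hi⟩ := hx
    rw [stepFun_of_mem hE hi, stepFun_of_mem hE hi, comp_apply]
  · push Not at hx
    rw [stepFun_of_notMem hx, stepFun_of_notMem hx, hg]

variable [MeasurableSpace α]

theorem measurable_stepFun (hE : ∀ i, MeasurableSet (E i)) : Measurable (stepFun E a) :=
  Finset.measurable_fun_sum _ fun i _ => measurable_const.indicator (hE i)

theorem integrable_stepFun (hE : ∀ i, MeasurableSet (E i)) (μ : Measure α) [IsFiniteMeasure μ] :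
    Integrable (stepFun E a) μ :=
  integrable_finsetSum _ fun i _ => (integrable_const _).indicator (hE i)

theorem integral_stepFun (hE : ∀ i, MeasurableSet (E i)) (μ : Measure α) [IsFiniteMeasure μ] :
    ∫ x, stepFun E a x ∂μ = ∑ i, μ.real (E i) * a i := by
  simp only [stepFun]
  rw [integral_finsetSum _ fun i _ => (integrable_const _).indicator (hE i)]
  simp only [integral_indicator_const _ (hE _), smul_eq_mul]

theorem withDensity_stepFun (hE : ∀ i, MeasurableSet (E i)) (ha : ∀ i, 0 ≤ a i) (μ : Measure α) :
    μ.withDensity (fun x => ENNReal.ofReal (stepFun E a x)) =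
      ∑ i, ENNReal.ofReal (a i) • μ.restrict (E i) := by
  have indicator_lintegral (S : Set α) (i : ι) :
      ∫⁻ x in S, ENNReal.ofReal ((E i).indicator (fun _ => a i) x) ∂μ =
        ENNReal.ofReal (a i) * μ.restrict S (E i) := by
    rw [← lintegral_indicator_const (hE i)]
    congr with x
    by_cases hx : x ∈ E i <;> simp [hx]
  ext S hS
  simp only [stepFun]
  rw [withDensity_apply _ hS]
  simp only [ENNReal.ofReal_sum_of_nonneg fun i _ => Set.indicator_nonneg (fun _ _ => ha i) _]
  rw [lintegral_finsetSum _ fun i _ => (measurable_const.indicator (hE i)).ennreal_ofReal]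
  simp [indicator_lintegral, Measure.restrict_apply hS, Measure.restrict_apply (hE _),
    Set.inter_comm]

end StepFun

section Variational

theorem mul_log_add_one_sub_le_klFun {x r : ℝ} (hx : 0 ≤ x) (hr : 0 ≤ r) (h : r = 0 → x = 0) :
    x * Real.log r + 1 - r ≤ klFun x := by
  rcases hx.eq_or_lt with rfl | hx
  · simpa [klFun_zero] using hr
  have hr : 0 < r := hr.lt_of_ne' fun h0 => hx.ne' (h h0)
  have hlog := mul_le_mul_of_nonneg_left (Real.log_le_sub_one_of_pos (div_pos hr hx)) hx.le
  rw [Real.log_div hr.ne' hx.ne', mul_sub_one, mul_div_cancel₀ _ hx.ne'] at hlog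
  rw [klFun_apply]
  linarith

variable {α ι : Type*} [MeasurableSpace α] (μ ν : Measure α) [IsFiniteMeasure μ]
  [IsFiniteMeasure ν]

theorem integral_log_add_sub_integral_le_klDiv {r : α → ℝ} (hr0 : ∀ x, 0 ≤ r x)
    (hrμ : ∀ᵐ x ∂μ, r x ≠ 0) (hr : Integrable r ν)
    (hlog : Integrable (fun x => Real.log (r x)) μ) :
    ENNReal.ofReal (∫ x, Real.log (r x) ∂μ + ν.real Set.univ - ∫ x, r x ∂ν) ≤ klDiv μ ν := by
  by_cases hac : μ ≪ ν
  swap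
  · simp [klDiv_of_not_ac hac]
  by_cases hint : Integrable (llr μ ν) μ
  swap
  · simp [klDiv_of_not_integrable hint]
  rw [klDiv_eq_integral_klFun, if_pos ⟨hac, hint⟩, ← integral_rnDeriv_smul hac]
  refine ENNReal.ofReal_le_ofReal ?_
  have hlogν := (integrable_rnDeriv_smul_iff hac).2 hlog
  have hadd : Integrable (fun x => (μ.rnDeriv ν x).toReal • Real.log (r x) + 1) ν :=
    hlogν.add (integrable_const 1)
  have rnDeriv_eq_zero : ∀ᵐ x ∂ν, r x = 0 → (μ.rnDeriv ν x).toReal = 0 := by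
    rw [← Measure.withDensity_rnDeriv_eq μ ν hac,
      ae_withDensity_iff (Measure.measurable_rnDeriv μ ν)] at hrμ
    filter_upwards [hrμ] with x hx hrx
    simp [not_imp_not.1 hx hrx]
  calc _ = ∫ x, (μ.rnDeriv ν x).toReal • Real.log (r x) + 1 - r x ∂ν := by
        rw [integral_sub hadd hr,
          integral_add hlogν (integrable_const 1), integral_const, smul_eq_mul, mul_one]
    _ ≤ ∫ x, klFun (μ.rnDeriv ν x).toReal ∂ν := by
        refine integral_mono_ae (hadd.sub hr)
          ((integrable_klFun_rnDeriv_iff hac).2 hint) ?_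
        filter_upwards [rnDeriv_eq_zero] with x hx
        exact mul_log_add_one_sub_le_klFun ENNReal.toReal_nonneg (hr0 x) hx

theorem sum_log_add_sub_sum_le_klDiv [Fintype ι] {E : ι → Set α}
    (hEm : ∀ i, MeasurableSet (E i)) (hE : Pairwise (Disjoint on E)) (hμ : ∀ᵐ x ∂μ, ∃ i, x ∈ E i)
    {a : ι → ℝ} (ha : ∀ i, 0 ≤ a i) (haμ : ∀ i, a i = 0 → μ (E i) = 0) :
    ENNReal.ofReal (∑ i, μ.real (E i) * Real.log (a i) + ν.real Set.univ
      - ∑ i, ν.real (E i) * a i) ≤ klDiv μ ν := by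
  have hlog (x : α) := comp_stepFun (a := a) hE Real.log_zero x
  have ae_ne_zero : ∀ᵐ x ∂μ, stepFun E a x ≠ 0 := by
    have hnull : ∀ᵐ x ∂μ, ∀ i, a i = 0 → x ∉ E i :=
      ae_all_iff.2 fun i => by
        by_cases hi : a i = 0
        · simpa [hi] using measure_eq_zero_iff_ae_notMem.1 (haμ i hi)
        · simp [hi]
    filter_upwards [hμ, hnull] with x ⟨i, hi⟩ hx hzero
    exact hx i ((stepFun_of_mem hE hi).symm.trans hzero) hi
  have h := integral_log_add_sub_integral_le_klDiv μ ν (stepFun_nonneg ha) ae_ne_zero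
    (integrable_stepFun hEm ν) (by simpa only [hlog] using integrable_stepFun hEm μ)
  simpa only [hlog, integral_stepFun hEm, comp_apply] using h

theorem neg_log_le_klDiv {μ ν : Measure α} [IsProbabilityMeasure μ] [IsProbabilityMeasure ν]
    {S : Set α} (hS : MeasurableSet S) (hμ : ∀ᵐ x ∂μ, x ∈ S) {x : ℝ} (hx : 0 < x)
    (hν : ν.real S ≤ x) : ENNReal.ofReal (-Real.log x) ≤ klDiv μ ν := by
  have hμS : μ.real S = 1 := by
    rw [measureReal_def, (mem_ae_iff_prob_eq_one hS).1 hμ, ENNReal.toReal_one]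
  refine le_trans (ENNReal.ofReal_le_ofReal ?_) (sum_log_add_sub_sum_le_klDiv μ ν
    (E := fun _ : Unit => S) (fun _ => hS) Subsingleton.pairwise (by simpa using hμ)
    (a := fun _ => x⁻¹) (fun _ => by positivity) fun _ h => absurd h (inv_pos.2 hx).ne')
  have : ν.real S * x⁻¹ ≤ 1 := by rwa [← div_eq_mul_inv, div_le_one hx]
  simp only [Finset.univ_unique, Finset.sum_singleton, hμS, Real.log_inv, probReal_univ]
  linarith

end Variational

section Mixture

variable {α ι : Type*} [MeasurableSpace α]

/-- The probability measures `U i` live on pairwise disjoint measurable cells `E i`. -/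
structure IsCellFamily (E : ι → Set α) (U : ι → Measure α) : Prop where
  measurableSet : ∀ i, MeasurableSet (E i)
  disjoint : Pairwise (Disjoint on E)
  isProbabilityMeasure : ∀ i, IsProbabilityMeasure (U i)
  apply_self : ∀ i, U i (E i) = 1

variable {E : ι → Set α} {U : ι → Measure α}

namespace IsCellFamily

theorem ae_mem (hU : IsCellFamily E U) (i : ι) : ∀ᵐ x ∂U i, x ∈ E i :=
  have := hU.isProbabilityMeasure i
  (mem_ae_iff_prob_eq_one (hU.measurableSet i)).2 (hU.apply_self i)

theorem restrict_self (hU : IsCellFamily E U) (i : ι) : (U i).restrict (E i) = U i :=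
  Measure.restrict_eq_self_of_ae_mem (hU.ae_mem i)

theorem apply_of_ne (hU : IsCellFamily E U) {i j : ι} (hij : i ≠ j) : U i (E j) = 0 :=
  measure_eq_zero_iff_ae_notMem.2 <| (hU.ae_mem i).mono fun _ hx =>
    Set.disjoint_left.1 (hU.disjoint hij) hx

theorem restrict_of_ne (hU : IsCellFamily E U) {i j : ι} (hij : i ≠ j) :
    (U i).restrict (E j) = 0 :=
  Measure.restrict_eq_zero.2 (hU.apply_of_ne hij)

end IsCellFamily

theorem isCellFamily_cond {μ : Measure α} (hEm : ∀ i, MeasurableSet (E i))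
    (hE : Pairwise (Disjoint on E)) (hμ : ∀ i, μ.real (E i) ≠ 0) :
    IsCellFamily E fun i => μ[|E i] where
  measurableSet := hEm
  disjoint := hE
  isProbabilityMeasure i :=
    cond_isProbabilityMeasure_of_finite (ENNReal.toReal_ne_zero.1 (hμ i)).1
      (ENNReal.toReal_ne_zero.1 (hμ i)).2
  apply_self i :=
    cond_apply_self (ENNReal.toReal_ne_zero.1 (hμ i)).1 (ENNReal.toReal_ne_zero.1 (hμ i)).2

variable [Fintype ι] {p g : ι → ℝ}

/-- The mixture of the measures `U i` with weights `p i`. -/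
noncomputable def mixture (U : ι → Measure α) (p : ι → ℝ) : Measure α :=
  ∑ i, ENNReal.ofReal (p i) • U i

theorem smul_le_mixture (p : ι → ℝ) (i : ι) : ENNReal.ofReal (p i) • U i ≤ mixture U p :=
  Finset.single_le_sum (f := fun i => ENNReal.ofReal (p i) • U i)
    (fun _ _ => Measure.zero_le _) (Finset.mem_univ i)

theorem mixture_real_apply [∀ i, IsFiniteMeasure (U i)] (hp : ∀ i, 0 ≤ p i) (S : Set α) :
    (mixture U p).real S = ∑ i, p i * (U i).real S := by
  simp only [mixture, measureReal_def, Measure.finsetSum_apply, Measure.smul_apply, smul_eq_mul]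
  rw [ENNReal.toReal_sum fun i _ => ENNReal.mul_ne_top ENNReal.ofReal_ne_top (measure_ne_top _ _)]
  simp only [ENNReal.toReal_mul, ENNReal.toReal_ofReal (hp _)]

theorem restrict_mixture (p : ι → ℝ) (S : Set α) :
    (mixture U p).restrict S = ∑ i, ENNReal.ofReal (p i) • (U i).restrict S := by
  rw [mixture, ← Measure.restrictₗ_apply, map_sum]
  simp only [Measure.restrictₗ_apply, Measure.restrict_smul]

theorem mixture_cond {μ : Measure α} (hE : ∀ i, MeasurableSet (E i))
    (hμ : ∀ i, μ.real (E i) ≠ 0) (hp : ∀ i, 0 ≤ p i) :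
    mixture (fun i => μ[|E i]) p =
      μ.withDensity fun x => ENNReal.ofReal (stepFun E (fun i => p i / μ.real (E i)) x) := by
  rw [withDensity_stepFun hE fun i => div_nonneg (hp i) measureReal_nonneg]
  refine Finset.sum_congr rfl fun i _ => ?_
  have hfin : μ (E i) ≠ ∞ := fun h => hμ i (by simp [measureReal_def, h])
  change ENNReal.ofReal (p i) • ((μ (E i))⁻¹ • μ.restrict (E i)) = _
  rw [smul_smul, ENNReal.ofReal_div_of_pos (measureReal_nonneg.lt_of_ne' (hμ i)),
    measureReal_def, ENNReal.ofReal_toReal hfin, div_eq_mul_inv]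

namespace IsCellFamily

theorem restrict_mixture_cell (hU : IsCellFamily E U) (p : ι → ℝ) (i : ι) :
    (mixture U p).restrict (E i) = ENNReal.ofReal (p i) • U i := by
  rw [restrict_mixture, Fintype.sum_eq_single i fun j hji => by
    rw [hU.restrict_of_ne hji, smul_zero], hU.restrict_self]

theorem mixture_apply (hU : IsCellFamily E U) (p : ι → ℝ) (i : ι) :
    mixture U p (E i) = ENNReal.ofReal (p i) := by
  rw [← Measure.restrict_apply_self, hU.restrict_mixture_cell, Measure.smul_apply, hU.apply_self,
    smul_eq_mul, mul_one]

theorem mixture_real (hU : IsCellFamily E U) (hp : ∀ i, 0 ≤ p i) (i : ι) :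
    (mixture U p).real (E i) = p i := by
  rw [measureReal_def, hU.mixture_apply, ENNReal.toReal_ofReal (hp i)]

theorem isProbabilityMeasure_mixture (hU : IsCellFamily E U) (hp : p ∈ stdSimplex ℝ ι) :
    IsProbabilityMeasure (mixture U p) := by
  have (i : ι) : U i Set.univ = 1 := (hU.isProbabilityMeasure i).measure_univ
  constructor
  simp [mixture, this, ← ENNReal.ofReal_sum_of_nonneg fun i _ => hp.1 i, hp.2]

theorem ae_mixture_mem (hU : IsCellFamily E U) (p : ι → ℝ) :
    ∀ᵐ x ∂mixture U p, ∃ i, x ∈ E i := by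
  rw [ae_iff, mixture, Measure.finsetSum_apply]
  refine Finset.sum_eq_zero fun i _ => ?_
  have : U i {x | ¬∃ i, x ∈ E i} = 0 := (hU.ae_mem i).mono fun _ hx => ⟨i, hx⟩
  rw [Measure.smul_apply, this, smul_zero]

theorem mixture_eq_withDensity (hU : IsCellFamily E U) (hp : ∀ i, 0 ≤ p i) (hg : ∀ i, 0 ≤ g i)
    (hpg : ∀ i, g i = 0 → p i = 0) :
    mixture U p =
      (mixture U g).withDensity fun x => ENNReal.ofReal (stepFun E (fun i => p i / g i) x) := by
  rw [withDensity_stepFun hU.measurableSet fun i => div_nonneg (hp i) (hg i)]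
  refine Finset.sum_congr rfl fun i _ => ?_
  rw [hU.restrict_mixture_cell, smul_smul, ← ENNReal.ofReal_mul (div_nonneg (hp i) (hg i)),
    div_mul_cancel_of_imp (hpg i)]

theorem klDiv_mixture (hU : IsCellFamily E U) (hp : p ∈ stdSimplex ℝ ι)
    (hg : g ∈ stdSimplex ℝ ι) (hpg : ∀ i, g i = 0 → p i = 0) :
    klDiv (mixture U p) (mixture U g) = ENNReal.ofReal (∑ i, p i * Real.log (p i / g i)) := by
  have := hU.isProbabilityMeasure_mixture hp
  have := hU.isProbabilityMeasure_mixture hg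
  have hdens := hU.mixture_eq_withDensity hp.1 hg.1 hpg
  have hac : mixture U p ≪ mixture U g := hdens ▸ withDensity_absolutelyContinuous _ _
  have hllr : llr (mixture U p) (mixture U g) =ᵐ[mixture U p]
      stepFun E (Real.log ∘ (fun i => p i / g i)) := by
    refine hac.ae_eq ?_
    have hrn := Measure.rnDeriv_withDensity (mixture U g)
      (measurable_stepFun (a := fun i => p i / g i) hU.measurableSet).ennreal_ofReal
    rw [← hdens] at hrn
    filter_upwards [hrn] with x hx
    simp only [llr_def]
    rw [hx, ENNReal.toReal_ofReal
      (stepFun_nonneg (fun i => div_nonneg (hp.1 i) (hg.1 i)) x),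
      comp_stepFun hU.disjoint Real.log_zero]
  rw [klDiv_of_ac_of_integrable hac ((integrable_congr hllr).2
    (integrable_stepFun hU.measurableSet _)), integral_congr_ae hllr,
    integral_stepFun hU.measurableSet]
  simp [hU.mixture_real hp.1]

end IsCellFamily

/-- The weights obtained from the probability weights `p` by conditioning on the complement
of cell `k`. -/
noncomputable def deleteCell [DecidableEq ι] (p : ι → ℝ) (k i : ι) : ℝ :=
  if i = k then 0 else p i / (1 - p k)

theorem deleteCell_mem_stdSimplex [DecidableEq ι] (hp : p ∈ stdSimplex ℝ ι) {k : ι}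
    (hk : p k < 1) : deleteCell p k ∈ stdSimplex ℝ ι := by
  have hpos : 0 < 1 - p k := sub_pos.2 hk
  refine ⟨fun i => ?_, ?_⟩
  · unfold deleteCell
    split_ifs
    exacts [le_rfl, div_nonneg (hp.1 i) hpos.le]
  · have hsum : ∑ i ∈ Finset.univ.erase k, p i = 1 - p k := by
      rw [Finset.sum_erase_eq_sub (Finset.mem_univ k), hp.2]
    have hne (i : ι) (hi : i ∈ Finset.univ.erase k) : deleteCell p k i = p i / (1 - p k) :=
      if_neg (Finset.ne_of_mem_erase hi)
    rw [← Finset.sum_erase _ (show deleteCell p k k = 0 from if_pos rfl),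
      Finset.sum_congr rfl hne, ← Finset.sum_div, hsum, div_self hpos.ne']

theorem IsCellFamily.cond_compl_mixture [DecidableEq ι] (hU : IsCellFamily E U)
    (hp : p ∈ stdSimplex ℝ ι) {k : ι} (hk : p k < 1) :
    (mixture U p)[|(E k)ᶜ] = mixture U (deleteCell p k) := by
  have := hU.isProbabilityMeasure_mixture hp
  have hpos : 0 < 1 - p k := sub_pos.2 hk
  have hmass : mixture U p (E k)ᶜ = ENNReal.ofReal (1 - p k) := by
    rw [prob_compl_eq_one_sub (hU.measurableSet k), hU.mixture_apply,
      ENNReal.ofReal_sub _ (hp.1 k), ENNReal.ofReal_one]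
  rw [ProbabilityTheory.cond, hmass, restrict_mixture, Finset.smul_sum, mixture]
  refine Finset.sum_congr rfl fun i _ => ?_
  obtain rfl | hik := eq_or_ne i k
  · have hzero : (U i).restrict (E i)ᶜ = 0 := Measure.restrict_eq_zero.2 (hU.ae_mem i)
    simp [hzero, deleteCell]
  · have hself : (U i).restrict (E k)ᶜ = U i := Measure.restrict_eq_self_of_ae_mem <|
      (hU.ae_mem i).mono fun _ hx => Set.disjoint_left.1 (hU.disjoint hik) hx
    rw [hself, deleteCell, if_neg hik, smul_smul, ENNReal.ofReal_div_of_pos hpos, mul_comm,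
      div_eq_mul_inv]

end Mixture

section Spread

variable {T : Type*}

/-- The probability weights on `Option T` that put mass `1 - η` on `none` and spread the mass `η`
uniformly over `S`. -/
noncomputable def spread [DecidableEq T] (η : ℝ) (S : Finset T) : Option T → ℝ
  | none => 1 - η
  | some t => if t ∈ S then η / #S else 0

variable [DecidableEq T] {η : ℝ} {S S' : Finset T}

@[simp]
theorem spread_none (η : ℝ) (S : Finset T) : spread η S none = 1 - η := rfl

theorem spread_some_of_mem (η : ℝ) {t : T} (ht : t ∈ S) : spread η S (some t) = η / #S :=
  if_pos ht

theorem spread_some_of_notMem (η : ℝ) {t : T} (ht : t ∉ S) : spread η S (some t) = 0 :=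
  if_neg ht

theorem spread_singleton (η : ℝ) (t : T) : spread η {t} (some t) = η := by
  rw [spread_some_of_mem η (Finset.mem_singleton_self t), Finset.card_singleton, Nat.cast_one,
    div_one]

variable [Fintype T]

theorem spread_mem_stdSimplex (hη0 : 0 ≤ η) (hη1 : η ≤ 1) (hS : S.Nonempty) :
    spread η S ∈ stdSimplex ℝ (Option T) := by
  refine ⟨?_, ?_⟩
  · rintro (_ | t)
    · exact sub_nonneg.2 hη1
    · simp only [spread]
      positivity
  · have : (#S : ℝ) ≠ 0 := by simpa using hS.ne_empty
    rw [Fintype.sum_option]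
    simp only [spread, Finset.sum_ite_mem, Finset.univ_inter, Finset.sum_const, nsmul_eq_mul]
    field_simp
    ring

theorem IsCellFamily.klDiv_spread {α : Type*} [MeasurableSpace α] {E : Option T → Set α}
    {U : Option T → Measure α} (hU : IsCellFamily E U) (hη0 : 0 < η) (hη1 : η < 1)
    (hS : S.Nonempty) (hSS' : S ⊆ S') :
    klDiv (mixture U (spread η S)) (mixture U (spread η S')) =
      ENNReal.ofReal (η * Real.log (#S' / #S)) := by
  have hS' : S'.Nonempty := hS.mono hSS'
  have hSpos : (0 : ℝ) < #S := by simpa using hS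
  have hS'pos : (0 : ℝ) < #S' := by simpa using hS'
  rw [hU.klDiv_mixture (spread_mem_stdSimplex hη0.le hη1.le hS)
    (spread_mem_stdSimplex hη0.le hη1.le hS')]
  · have hterm (t : T) :
        spread η S (some t) * Real.log (spread η S (some t) / spread η S' (some t)) =
          if t ∈ S then η / #S * Real.log (#S' / #S) else 0 := by
      split_ifs with ht
      · rw [spread_some_of_mem η ht, spread_some_of_mem η (hSS' ht),
          div_div_div_cancel_left' _ _ hη0.ne']
      · rw [spread_some_of_notMem η ht, zero_mul]
    rw [Fintype.sum_option, spread_none, spread_none, div_self (sub_pos.2 hη1).ne', Real.log_one,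
      mul_zero, zero_add, Fintype.sum_congr _ _ hterm, Finset.sum_ite_mem, Finset.univ_inter,
      Finset.sum_const, nsmul_eq_mul, ← mul_assoc, mul_div_cancel₀ _ hSpos.ne']
  · rintro (_ | t) h
    · exact absurd h (sub_pos.2 hη1).ne'
    · refine spread_some_of_notMem η fun ht => ?_
      rw [spread_some_of_mem η (hSS' ht)] at h
      exact (div_pos hη0 hS'pos).ne' h

end Spread

section Averaging

variable {α T : Type*} [MeasurableSpace α] {μ ν : Measure α}

theorem measure_pi_mono {ι : Type*} [Fintype ι] {α : ι → Type*} [∀ i, MeasurableSpace (α i)]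
    {μ ν : ∀ i, Measure (α i)} (h : ∀ i, μ i ≤ ν i) : Measure.pi μ ≤ Measure.pi ν := by
  have houter : OuterMeasure.pi (fun i => (μ i).toOuterMeasure) ≤
      OuterMeasure.pi (fun i => (ν i).toOuterMeasure) :=
    OuterMeasure.le_pi.2 fun s _ => (OuterMeasure.pi_pi_le _ s).trans
      (Finset.prod_le_prod' fun i _ => h i (s i))
  refine Measure.le_iff.2 fun s hs => ?_
  rw [Measure.pi_def, Measure.pi_def, toMeasure_apply _ _ hs, toMeasure_apply _ _ hs]
  exact houter s

theorem mul_measure_le_lintegral {G : Set α} (hG : MeasurableSet G) {c : ℝ≥0∞} {f : α → ℝ≥0∞}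
    (h : ∀ᵐ x ∂μ, x ∈ G → c ≤ f x) : c * μ G ≤ ∫⁻ x, f x ∂μ :=
  calc c * μ G = ∫⁻ _ in G, c ∂μ := (setLIntegral_const G c).symm
    _ ≤ ∫⁻ x in G, f x ∂μ := setLIntegral_mono_ae' hG h
    _ ≤ ∫⁻ x, f x ∂μ := setLIntegral_le_lintegral _ _

variable [Fintype T]

theorem card_sub_le_card_filter {v : T → ℝ} (hv : ∀ t, 0 ≤ v t) {u ρ : ℝ} (hρ : 0 ≤ ρ)
    (hu : ∑ t, v t ≤ u) [DecidablePred fun t => ρ * v t ≤ u] :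
    (Fintype.card T : ℝ) - ρ ≤ #{t | ρ * v t ≤ u} := by
  let bad : Finset T := {t | ¬ρ * v t ≤ u}
  have hcard : (#{t | ρ * v t ≤ u} : ℝ) + #bad = Fintype.card T := by
    exact_mod_cast Finset.card_filter_add_card_filter_not _
  suffices (#bad : ℝ) ≤ ρ by linarith
  by_contra! hlt
  have hne : bad.Nonempty := Finset.card_pos.1 (by exact_mod_cast hρ.trans_lt hlt)
  have hu0 : 0 ≤ u := (Finset.sum_nonneg fun t _ => hv t).trans hu
  have : #bad * u < ρ * u := calc
    #bad * u = ∑ _t ∈ bad, u := by rw [Finset.sum_const, nsmul_eq_mul]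
    _ < ∑ t ∈ bad, ρ * v t :=
      Finset.sum_lt_sum_of_nonempty hne fun t ht => not_le.1 (Finset.mem_filter.1 ht).2
    _ ≤ ∑ t, ρ * v t :=
      Finset.sum_le_univ_sum_of_nonneg fun t => mul_nonneg hρ (hv t)
    _ ≤ ρ * u := by
      rw [← Finset.mul_sum]
      exact mul_le_mul_of_nonneg_left hu hρ
  exact this.not_ge (mul_le_mul_of_nonneg_right hlt.le hu0)

theorem exists_div_card_mul_le_measureReal [Nonempty T] [IsFiniteMeasure ν] {G : T → Set α}
    (hG : ∀ t, MeasurableSet (G t)) [∀ x, DecidablePred fun t => x ∈ G t] {k : ℝ}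
    (hk : ∀ x, k ≤ #{t | x ∈ G t}) :
    ∃ t, k / Fintype.card T * ν.real Set.univ ≤ ν.real (G t) := by
  have hint (t : T) : Integrable ((G t).indicator fun _ => (1 : ℝ)) ν :=
    (integrable_const 1).indicator (hG t)
  have hsum : ∑ _t : T, k / Fintype.card T * ν.real Set.univ ≤ ∑ t, ν.real (G t) := calc
    _ = ∫ _x, k ∂ν := by
      rw [integral_const, smul_eq_mul, Finset.sum_const, Finset.card_univ, nsmul_eq_mul]
      field_simp
    _ ≤ ∫ x, ∑ t, (G t).indicator (fun _ => (1 : ℝ)) x ∂ν := by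
      refine integral_mono (integrable_const k) (integrable_finsetSum _ fun t _ => hint t)
        fun x => (hk x).trans_eq ?_
      simp [Set.indicator_apply]
    _ = ∑ t, ν.real (G t) := by
      simp only [integral_finsetSum _ fun t _ => hint t, integral_indicator_const _ (hG _),
        smul_eq_mul, mul_one]
  obtain ⟨t, -, ht⟩ := Finset.exists_le_of_sum_le Finset.univ_nonempty hsum
  exact ⟨t, ht⟩

end Averaging

section Spike

variable {α T : Type*} [MeasurableSpace α] [Fintype T]
  {E : Option T → Set α} {U : Option T → Measure α} {η ρ q : ℝ}

theorem IsCellFamily.sum_measureReal_some_le (hU : IsCellFamily E U) (ν : Measure α)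
    [IsProbabilityMeasure ν] : ∑ t, ν.real (E (some t)) ≤ 1 - ν.real (E none) := by
  have hle : ν.real (⋃ i, E i) ≤ 1 := measureReal_le_one
  rw [measureReal_iUnion_fintype hU.disjoint hU.measurableSet, Fintype.sum_option] at hle
  linarith

variable [DecidableEq T]

theorem IsCellFamily.mul_log_le_klDiv_spike (hU : IsCellFamily E U) (hη0 : 0 ≤ η) (hη1 : η ≤ 1)
    (hρ : 0 < ρ) {t : T} (ν : Measure α) [IsProbabilityMeasure ν]
    (hν : ρ * ν.real (E (some t)) ≤ 1 - ν.real (E none)) :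
    ENNReal.ofReal (η * Real.log ρ) ≤ klDiv (mixture U (spread η {t})) ν := by
  have hp := spread_mem_stdSimplex hη0 hη1 (Finset.singleton_nonempty t)
  have := hU.isProbabilityMeasure_mixture hp
  let a : Option T → ℝ := fun i => i.elim 1 fun s => if s = t then ρ else 0
  have ha (i : Option T) : 0 ≤ a i := by
    rcases i with _ | s
    · exact zero_le_one
    · exact ite_nonneg hρ.le le_rfl
  have ha_null (i : Option T) (hi : a i = 0) : mixture U (spread η {t}) (E i) = 0 := by
    rcases i with _ | s
    · exact absurd hi one_ne_zero
    · have hst : s ∉ ({t} : Finset T) := fun hst =>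
        hρ.ne' ((if_pos (Finset.mem_singleton.1 hst)).symm.trans hi)
      rw [hU.mixture_apply, spread_some_of_notMem η hst, ENNReal.ofReal_zero]
  refine le_trans (ENNReal.ofReal_le_ofReal ?_) (sum_log_add_sub_sum_le_klDiv _ ν
    hU.measurableSet hU.disjoint (hU.ae_mixture_mem _) ha ha_null)
  have hμ : ∑ i, (mixture U (spread η {t})).real (E i) * Real.log (a i) = η * Real.log ρ := by
    simp only [hU.mixture_real hp.1]
    rw [Fintype.sum_option, Fintype.sum_eq_single t fun s hs => by simp [a, hs], spread_singleton]
    simp [a]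
  have hν' : ∑ i, ν.real (E i) * a i = ν.real (E none) + ρ * ν.real (E (some t)) := by
    simp [Fintype.sum_option, a, mul_comm ρ]
  rw [hμ, hν', probReal_univ]
  linarith

/- The samples lying entirely in the common cell do not tell the spikes apart, and the mass that
the prediction `Q D` leaves for the other cells cannot exceed its fair share in all of them. -/
theorem IsCellFamily.exists_le_lintegral_klDiv_spike [Nonempty T] (hU : IsCellFamily E U)
    (hη0 : 0 ≤ η) (hη1 : η ≤ 1) (hρ : 1 ≤ ρ) (hq : 0 ≤ q) {n : ℕ}
    (Q : Kernel (Fin n → α) α) [IsMarkovKernel Q] :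
    ∃ t : T, ENNReal.ofReal ((1 - η) ^ n * (1 - ρ / Fintype.card T) * (η * Real.log ρ) ^ q) ≤
      ∫⁻ D, klDiv (mixture U (spread η {t})) (Q D) ^ q
        ∂Measure.pi fun _ => mixture U (spread η {t}) := by
  classical
  have := hU.isProbabilityMeasure none
  have hlog : 0 ≤ η * Real.log ρ := mul_nonneg hη0 (Real.log_nonneg hρ)
  have hρ0 : 0 < ρ := one_pos.trans_le hρ
  have := (U none).smul_finite (ENNReal.ofReal_ne_top (r := 1 - η))
  let ν : Measure (Fin n → α) := Measure.pi fun _ => ENNReal.ofReal (1 - η) • U none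
  have hν_le (t : T) : ν ≤ Measure.pi fun _ => mixture U (spread η {t}) :=
    measure_pi_mono fun _ => smul_le_mixture (spread η {t}) none
  have hν_univ : ν.real Set.univ = (1 - η) ^ n := by
    simp [ν, measureReal_def, Measure.pi_univ, hη1]
  let G : T → Set (Fin n → α) := fun t =>
    {D | ρ * (Q D).real (E (some t)) ≤ 1 - (Q D).real (E none)}
  have hQ (i : Option T) : Measurable fun D => (Q D).real (E i) :=
    (Q.measurable_coe (hU.measurableSet i)).ennreal_toReal
  have hG (t : T) : MeasurableSet (G t) :=
    measurableSet_le ((hQ _).const_mul ρ) (measurable_const.sub (hQ _))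
  obtain ⟨t, ht⟩ := exists_div_card_mul_le_measureReal (ν := ν) hG fun D =>
    card_sub_le_card_filter (fun _ => measureReal_nonneg) hρ0.le
      (hU.sum_measureReal_some_le (Q D))
  have hcard : (Fintype.card T : ℝ) ≠ 0 := by exact_mod_cast Fintype.card_ne_zero
  rw [hν_univ, sub_div, div_self hcard, mul_comm] at ht
  refine ⟨t, ?_⟩
  calc _ ≤ ENNReal.ofReal ((η * Real.log ρ) ^ q * ν.real (G t)) := by
        rw [mul_comm]
        exact ENNReal.ofReal_le_ofReal
          (mul_le_mul_of_nonneg_left ht (Real.rpow_nonneg hlog q))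
    _ = ENNReal.ofReal (η * Real.log ρ) ^ q * ν (G t) := by
        rw [ENNReal.ofReal_mul (Real.rpow_nonneg hlog q), ENNReal.ofReal_rpow_of_nonneg hlog hq,
          ofReal_measureReal]
    _ ≤ ∫⁻ D, klDiv (mixture U (spread η {t})) (Q D) ^ q ∂ν :=
        mul_measure_le_lintegral (hG t) <| ae_of_all _ fun D hD => ENNReal.rpow_le_rpow
          (hU.mul_log_le_klDiv_spike hη0 hη1 hρ0 (Q D) hD) hq
    _ ≤ _ := lintegral_mono' (hν_le t) le_rfl

end Spike

section Unvisited

variable {α κ : Type*} {E : κ → Set α} {n : ℕ}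

/-- The union of the cells that are not visited by any point of the sample `D`. -/
def unvisited (E : κ → Set α) (D : Fin n → α) : Set α :=
  ⋃ k ∈ {k | ∀ i, D i ∉ E k}, E k

theorem subset_unvisited {D : Fin n → α} {k : κ} (hk : ∀ i, D i ∉ E k) : E k ⊆ unvisited E D :=
  Set.subset_biUnion_of_mem (s := {k | ∀ i, D i ∉ E k}) (u := E) hk

theorem setOf_forall_notMem_eq_pi (S : Set α) :
    {D : Fin n → α | ∀ i, D i ∉ S} = Set.univ.pi fun _ => Sᶜ := by
  ext D
  simp

variable [MeasurableSpace α] {P : Measure α} {q x : ℝ}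

theorem measurableSet_forall_notMem {S : Set α} (hS : MeasurableSet S) :
    MeasurableSet {D : Fin n → α | ∀ i, D i ∉ S} := by
  rw [setOf_forall_notMem_eq_pi]
  exact MeasurableSet.univ_pi fun _ => hS.compl

theorem measurableSet_unvisited [Countable κ] (hE : ∀ k, MeasurableSet (E k)) (D : Fin n → α) :
    MeasurableSet (unvisited E D) :=
  MeasurableSet.biUnion (Set.to_countable _) fun k _ => hE k

theorem restrict_le_cond [IsProbabilityMeasure P] (S : Set α) : P.restrict S ≤ P[|S] := by
  refine Measure.le_iff.2 fun s _ => ?_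
  rw [ProbabilityTheory.cond, Measure.smul_apply, smul_eq_mul]
  exact le_mul_of_one_le_left' (ENNReal.one_le_inv.2 prob_le_one)

theorem restrict_pi_forall_notMem_le_pi_cond [IsProbabilityMeasure P] (S : Set α) :
    (Measure.pi fun _ : Fin n => P).restrict {D | ∀ i, D i ∉ S} ≤
      Measure.pi fun _ => P[|Sᶜ] := by
  rw [setOf_forall_notMem_eq_pi, Measure.restrict_pi_pi]
  exact measure_pi_mono fun _ => restrict_le_cond _

theorem lintegral_klDiv_eq_top {β : Type*} [MeasurableSpace β] {μ : Measure α} {ν : Measure β}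
    {Q : Kernel β α} {S : Set α} (hS : MeasurableSet S) (hμ : μ S = 0) (hq : 0 < q)
    (hν : ν {D | Q D S ≠ 0} ≠ 0) : ∫⁻ D, klDiv (Q D) μ ^ q ∂ν = ∞ := by
  have hmeas : MeasurableSet {D | Q D S ≠ 0} :=
    (Q.measurable_coe hS) (measurableSet_singleton 0).compl
  refine eq_top_iff.2 <| (ENNReal.top_mul hν).symm.le.trans <|
    mul_measure_le_lintegral hmeas <| ae_of_all _ fun D hD => ?_
  rw [klDiv_of_not_ac fun hac => hD (hac hμ), ENNReal.top_rpow_of_pos hq]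

theorem ae_unvisited_null [Countable κ] [IsProbabilityMeasure P] (hE : ∀ k, MeasurableSet (E k))
    {Q : Kernel (Fin n → α) α}
    (hQ : ∀ k, (Measure.pi fun _ => P[|(E k)ᶜ]) {D | Q D (E k) ≠ 0} = 0) :
    ∀ᵐ D ∂Measure.pi fun _ => P, Q D (unvisited E D) = 0 := by
  have hnull : ∀ᵐ D ∂Measure.pi fun _ => P, ∀ k, (∀ i, D i ∉ E k) → Q D (E k) = 0 := by
    refine ae_all_iff.2 fun k => (ae_restrict_iff' (measurableSet_forall_notMem (hE k))).1 ?_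
    exact ae_mono (restrict_pi_forall_notMem_le_pi_cond _) (hQ k)
  filter_upwards [hnull] with D hD
  exact (measure_biUnion_null_iff (Set.to_countable _)).2 hD

/- If, for some `k`, the prediction charges the deleted cell `k`, then its divergence is infinite.
Otherwise it has to keep off all the unvisited cells, one of which is not known to be deleted. -/
theorem exists_le_lintegral_klDiv_cond_compl [Countable κ] [IsProbabilityMeasure P]
    (hE : ∀ k, MeasurableSet (E k)) (hP : ∀ k, P (E k)ᶜ ≠ 0) (hq : 0 < q) (hx0 : 0 < x)
    (hx1 : x ≤ 1) {G : Set (Fin n → α)} (hGm : MeasurableSet G) {j : κ}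
    (hj : ∀ D ∈ G, ∀ i, D i ∉ E j) (hG : ∀ D ∈ G, P[|(E j)ᶜ].real (unvisited E D)ᶜ ≤ x)
    (Q : Kernel (Fin n → α) α) [IsMarkovKernel Q] :
    ∃ k, ENNReal.ofReal ((-Real.log x) ^ q * (Measure.pi fun _ => P).real G) ≤
      ∫⁻ D, klDiv (Q D) P[|(E k)ᶜ] ^ q ∂Measure.pi fun _ => P[|(E k)ᶜ] := by
  by_cases hQ : ∃ k, (Measure.pi fun _ => P[|(E k)ᶜ]) {D | Q D (E k) ≠ 0} ≠ 0
  · obtain ⟨k, hk⟩ := hQ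
    have hdel : P[|(E k)ᶜ] (E k) = 0 := by simp [cond_apply (hE k).compl]
    exact ⟨k, le_top.trans (lintegral_klDiv_eq_top (hE k) hdel hq hk).ge⟩
  push Not at hQ
  have := cond_isProbabilityMeasure (hP j)
  have hlog : 0 ≤ -Real.log x := neg_nonneg.2 (Real.log_nonpos hx0.le hx1)
  have hloss : ∀ᵐ D ∂Measure.pi fun _ => P, D ∈ G →
      ENNReal.ofReal (-Real.log x) ^ q ≤ klDiv (Q D) P[|(E j)ᶜ] ^ q := by
    filter_upwards [ae_unvisited_null hE hQ] with D hD hDG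
    exact ENNReal.rpow_le_rpow (neg_log_le_klDiv (measurableSet_unvisited hE D).compl
      (measure_eq_zero_iff_ae_notMem.1 hD) hx0 (hG D hDG)) hq.le
  have hGsub : G ⊆ {D | ∀ i, D i ∉ E j} := hj
  refine ⟨j, ?_⟩
  calc _ = ENNReal.ofReal (-Real.log x) ^ q *
        ((Measure.pi fun _ => P).restrict {D | ∀ i, D i ∉ E j}) G := by
        rw [Measure.restrict_apply hGm, Set.inter_eq_left.2 hGsub,
          ENNReal.ofReal_mul (Real.rpow_nonneg hlog q),
          ENNReal.ofReal_rpow_of_nonneg hlog hq.le, ofReal_measureReal]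
    _ ≤ ∫⁻ D in {D | ∀ i, D i ∉ E j}, klDiv (Q D) P[|(E j)ᶜ] ^ q ∂Measure.pi fun _ => P :=
        mul_measure_le_lintegral hGm (ae_restrict_of_ae hloss)
    _ ≤ _ := lintegral_mono' (restrict_pi_forall_notMem_le_pi_cond _) le_rfl

end Unvisited

section FewVisits

variable {α κ : Type*} [MeasurableSpace α] [Fintype κ] {n : ℕ}

/-- The samples which avoid the cell `E j` and for which the weights `a k` of the cells `E k`
containing the sample points add up to at most `s`, with multiplicity. -/
def fewVisits (n : ℕ) (E : κ → Set α) (a : κ → ℝ) (j : κ) (s : ℝ) : Set (Fin n → α) :=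
  {D | (∀ i, D i ∉ E j) ∧ ∑ i, stepFun E a (D i) ≤ s}

theorem measurableSet_fewVisits {E : κ → Set α} (hE : ∀ k, MeasurableSet (E k)) (a : κ → ℝ)
    (j : κ) (s : ℝ) : MeasurableSet (fewVisits n E a j s) :=
  (measurableSet_forall_notMem (hE j)).inter
    (measurableSet_le (Finset.measurable_fun_sum _ fun i _ =>
      (measurable_stepFun hE).comp (measurable_pi_apply i)) measurable_const)

theorem one_sub_le_pi_sum_lt_one {P : Measure α} [IsProbabilityMeasure P] {f : α → ℝ}
    (hf0 : ∀ y, 0 ≤ f y) (hfm : Measurable f) (hf : Integrable f P) :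
    1 - n * ∫ y, f y ∂P ≤ (Measure.pi fun _ : Fin n => P).real {D | ∑ i, f (D i) < 1} := by
  have hint (i : Fin n) : Integrable (fun D : Fin n → α => f (D i)) (Measure.pi fun _ => P) :=
    integrable_comp_eval (μ := fun _ => P) hf
  have hmean : ∫ D, ∑ i, f (D i) ∂(Measure.pi fun _ : Fin n => P) = n * ∫ y, f y ∂P := by
    rw [integral_finsetSum _ fun i _ => hint i]
    simp only [integral_comp_eval (μ := fun _ : Fin n => P) hf.aestronglyMeasurable,
      Finset.sum_const, Finset.card_univ, Fintype.card_fin, nsmul_eq_mul]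
  have hmarkov := mul_meas_ge_le_integral_of_nonneg
    (ae_of_all _ fun D => Finset.sum_nonneg fun i _ => hf0 (D i))
    (integrable_finsetSum Finset.univ fun i _ => hint i) 1
  have hmeas : MeasurableSet {D : Fin n → α | ∑ i, f (D i) < 1} :=
    measurableSet_lt (Finset.measurable_fun_sum _ fun i _ => hfm.comp (measurable_pi_apply i))
      measurable_const
  have hcompl : {D : Fin n → α | 1 ≤ ∑ i, f (D i)} = {D | ∑ i, f (D i) < 1}ᶜ := by
    ext D
    simp
  rw [hcompl, probReal_compl_eq_one_sub hmeas, hmean] at hmarkov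
  linarith

/- Markov's inequality for the sum over the sample of `stepFun E a / s` plus the indicator
of `E j`. -/
theorem one_sub_le_pi_fewVisits {E : κ → Set α} (hEm : ∀ k, MeasurableSet (E k)) {a : κ → ℝ}
    (ha : ∀ k, 0 ≤ a k) {s : ℝ} (hs : 0 < s) (j : κ) (P : Measure α) [IsProbabilityMeasure P] :
    1 - n * ((∑ k, P.real (E k) * a k) / s + P.real (E j)) ≤
      (Measure.pi fun _ => P).real (fewVisits n E a j s) := by
  let f : α → ℝ := fun y => stepFun E a y / s + (E j).indicator (fun _ => 1) y
  have hind (y : α) : 0 ≤ (E j).indicator (fun _ => (1 : ℝ)) y :=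
    Set.indicator_nonneg (fun _ _ => zero_le_one) y
  have hstep (y : α) : 0 ≤ stepFun E a y / s := div_nonneg (stepFun_nonneg ha y) hs.le
  have hf0 (y : α) : 0 ≤ f y := add_nonneg (hstep y) (hind y)
  have hintstep : Integrable (fun y => stepFun E a y / s) P :=
    (integrable_stepFun hEm P).div_const s
  have hintind : Integrable ((E j).indicator fun _ => (1 : ℝ)) P :=
    (integrable_const 1).indicator (hEm j)
  have hmean : ∫ y, f y ∂P = (∑ k, P.real (E k) * a k) / s + P.real (E j) := by
    rw [integral_add hintstep hintind, integral_div, integral_stepFun hEm,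
      integral_indicator_const _ (hEm j), smul_eq_mul, mul_one]
  rw [← hmean]
  refine (one_sub_le_pi_sum_lt_one hf0 (((measurable_stepFun hEm).div_const s).add
    (measurable_const.indicator (hEm j))) (hintstep.add hintind)).trans
    (measureReal_mono fun D (hD : ∑ i, f (D i) < 1) => ⟨fun i hi => ?_, ?_⟩)
  · refine hD.not_ge ?_
    calc (1 : ℝ) = (E j).indicator (fun _ => 1) (D i) :=
          (Set.indicator_of_mem hi fun _ => (1 : ℝ)).symm
      _ ≤ f (D i) := le_add_of_nonneg_left (hstep _)
      _ ≤ ∑ i, f (D i) :=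
        Finset.single_le_sum (f := fun i => f (D i)) (fun i _ => hf0 _) (Finset.mem_univ i)
  · have hle : (∑ i, stepFun E a (D i)) / s ≤ ∑ i, f (D i) := by
      rw [Finset.sum_div]
      exact Finset.sum_le_sum fun i _ => le_add_of_nonneg_right (hind _)
    exact (div_le_one hs).1 (hle.trans hD.le)

variable {E : Option κ → Set α} {U : Option κ → Measure α} {p : Option κ → ℝ} {q x s : ℝ}

theorem IsCellFamily.pow_le_pi_fewVisits (hU : IsCellFamily E U)
    (hp : p ∈ stdSimplex ℝ (Option κ)) (a : κ → ℝ) (j : κ) (hs : 0 ≤ s) :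
    p none ^ n ≤ (Measure.pi fun _ => mixture U p).real
      (fewVisits n (fun k => E (some k)) a j s) := by
  have := hU.isProbabilityMeasure_mixture hp
  have hpow : (Measure.pi fun _ : Fin n => mixture U p).real (Set.univ.pi fun _ => E none) =
      p none ^ n := by
    rw [measureReal_def, Measure.pi_pi, ENNReal.toReal_prod]
    simp only [← measureReal_def, hU.mixture_real hp.1, Finset.prod_const, Finset.card_univ,
      Fintype.card_fin]
  rw [← hpow]
  refine measureReal_mono fun D hD => ?_
  have hD (i : Fin n) (k : κ) : D i ∉ E (some k) :=
    Set.disjoint_left.1 (hU.disjoint (Option.some_ne_none k).symm) (hD i (Set.mem_univ i))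
  exact ⟨fun i => hD i j, (Finset.sum_eq_zero fun i _ => stepFun_of_notMem (hD i)).trans_le hs⟩

theorem IsCellFamily.mixture_real_compl_unvisited_le (hU : IsCellFamily E U)
    (hp : ∀ i, 0 ≤ p i) (D : Fin n → α) :
    (mixture U p).real (unvisited (fun k => E (some k)) D)ᶜ ≤
      p none + ∑ i, stepFun (fun k => E (some k)) (fun k => p (some k)) (D i) := by
  have := hU.isProbabilityMeasure
  set S := (unvisited (fun k => E (some k)) D)ᶜ
  have hcell (k : κ) :
      p (some k) * (U (some k)).real S ≤
        ∑ i, (E (some k)).indicator (fun _ => p (some k)) (D i) := by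
    have hnonneg (i : Fin n) : 0 ≤ (E (some k)).indicator (fun _ => p (some k)) (D i) :=
      Set.indicator_nonneg (fun _ _ => hp _) _
    by_cases hk : ∃ i, D i ∈ E (some k)
    · obtain ⟨i, hi⟩ := hk
      calc _ ≤ p (some k) := mul_le_of_le_one_right (hp _) measureReal_le_one
        _ = (E (some k)).indicator (fun _ => p (some k)) (D i) :=
          (Set.indicator_of_mem hi (fun _ => p (some k))).symm
        _ ≤ _ := Finset.single_le_sum
          (f := fun i => (E (some k)).indicator (fun _ => p (some k)) (D i))
          (fun i _ => hnonneg i) (Finset.mem_univ i)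
    · have hnull : U (some k) S = 0 := measure_mono_null
        (Set.compl_subset_compl.2 (subset_unvisited (not_exists.1 hk)))
        (hU.ae_mem (some k))
      rw [measureReal_def, hnull, ENNReal.toReal_zero, mul_zero]
      exact Finset.sum_nonneg fun i _ => hnonneg i
  calc (mixture U p).real S = p none * (U none).real S + ∑ k, p (some k) * (U (some k)).real S := by
        rw [mixture_real_apply hp, Fintype.sum_option]
    _ ≤ p none + ∑ k, ∑ i, (E (some k)).indicator (fun _ => p (some k)) (D i) :=
        add_le_add (mul_le_of_le_one_right (hp _) measureReal_le_one)
          (Finset.sum_le_sum fun k _ => hcell k)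
    _ = _ := by rw [Finset.sum_comm]; rfl

theorem IsCellFamily.exists_le_lintegral_klDiv_deleteCell [DecidableEq κ]
    (hU : IsCellFamily E U) (hp : p ∈ stdSimplex ℝ (Option κ)) (hp1 : ∀ k, p (some k) < 1)
    (hq : 0 < q) (hx0 : 0 < x) (hx1 : x ≤ 1) {j : κ}
    (hs : p none + s ≤ x * (1 - p (some j))) (Q : Kernel (Fin n → α) α) [IsMarkovKernel Q] :
    ∃ k, ENNReal.ofReal ((-Real.log x) ^ q * (Measure.pi fun _ => mixture U p).real
        (fewVisits n (fun k => E (some k)) (fun k => p (some k)) j s)) ≤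
      ∫⁻ D, klDiv (Q D) (mixture U (deleteCell p (some k))) ^ q
        ∂Measure.pi fun _ => mixture U (deleteCell p (some k)) := by
  have := hU.isProbabilityMeasure_mixture hp
  have hE (k : κ) : MeasurableSet (E (some k)) := hU.measurableSet _
  have hcompl (k : κ) : (mixture U p).real (E (some k))ᶜ = 1 - p (some k) := by
    rw [probReal_compl_eq_one_sub (hE k), hU.mixture_real hp.1]
  have hne (k : κ) : mixture U p (E (some k))ᶜ ≠ 0 := fun h => by
    have := hcompl k
    rw [measureReal_def, h, ENNReal.toReal_zero] at this
    linarith [hp1 k]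
  have hunvisited (D) (hD : D ∈ fewVisits n (fun k => E (some k)) (fun k => p (some k)) j s) :
      (mixture U p)[|(E (some j))ᶜ].real (unvisited (fun k => E (some k)) D)ᶜ ≤ x := by
    rw [measureReal_def, cond_apply (hE j).compl, ENNReal.toReal_mul, ENNReal.toReal_inv,
      ← measureReal_def, ← measureReal_def, hcompl, inv_mul_le_iff₀ (sub_pos.2 (hp1 j)), mul_comm]
    calc _ ≤ (mixture U p).real (unvisited (fun k => E (some k)) D)ᶜ :=
          measureReal_mono Set.inter_subset_right
      _ ≤ p none + s := (hU.mixture_real_compl_unvisited_le hp.1 D).trans (by gcongr; exact hD.2)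
      _ ≤ x * (1 - p (some j)) := hs
  simp only [← fun k => hU.cond_compl_mixture hp (hp1 k)]
  exact exists_le_lintegral_klDiv_cond_compl hE hne hq hx0 hx1
    (measurableSet_fewVisits hE _ j s) (fun D hD => hD.1) hunvisited Q

end FewVisits

section UniformDeletion

theorem exists_forall_log_le_mul {ε : ℝ} (hε : 0 < ε) :
    ∃ N : ℕ, ∀ M : ℕ, N ≤ M → Real.log M ≤ ε * M := by
  have h := tendsto_natCast_atTop_atTop (R := ℝ) |>.eventually (Real.isLittleO_log_id_atTop.def hε)
  obtain ⟨N, hN⟩ := Filter.eventually_atTop.1 h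
  exact ⟨N, fun M hM => by simpa using (le_abs_self _).trans (hN M hM)⟩

theorem sq_le_mul_one_sub_div {x m : ℝ} (hx0 : 0 ≤ x) (hx1 : x ≤ 1) (hm : 2 ≤ m) :
    x ^ 2 ≤ x * (1 - (1 - x ^ 2) / m) := by
  have hle : (1 - x ^ 2) / m ≤ (1 - x ^ 2) / 2 := by
    gcongr
    nlinarith
  calc x ^ 2 = x * x := sq x
    _ ≤ x * (1 - (1 - x ^ 2) / m) := mul_le_mul_of_nonneg_left (by nlinarith) hx0

theorem sq_add_le_mul_one_sub_div {x m : ℝ} (hx0 : 0 ≤ x) (hx1 : x ≤ 1) (hm : 4 ≤ m) :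
    x ^ 2 + (1 - x ^ 2) * x / 4 ≤ x * (1 - (1 - x ^ 2) / m) := by
  have hle : (1 - x ^ 2) / m ≤ (1 - x ^ 2) / 4 := by
    gcongr
    nlinarith
  calc x ^ 2 + (1 - x ^ 2) * x / 4 = x * (x + (1 - x ^ 2) / 4) := by ring
    _ ≤ x * (1 - (1 - x ^ 2) / m) := mul_le_mul_of_nonneg_left (by nlinarith) hx0

theorem one_sub_exp_neg_sq_le (L : ℝ) : 1 - Real.exp (-L) ^ 2 ≤ 2 * L := by
  rw [← Real.exp_nat_mul]
  have := Real.add_one_le_exp (-(2 * L))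
  push_cast
  linarith [mul_neg 2 L ▸ this]

variable {α κ : Type*} [MeasurableSpace α] [Fintype κ] [DecidableEq κ]
  {E : Option κ → Set α} {U : Option κ → Measure α} {n : ℕ}

theorem IsCellFamily.one_sub_le_pi_fewVisits_spread (hU : IsCellFamily E U) {η s : ℝ}
    (hη0 : 0 ≤ η) (hη1 : η ≤ 1) (hs : 0 < s) (j : κ) :
    1 - n * (η ^ 2 / (Fintype.card κ * s) + η / Fintype.card κ) ≤
      (Measure.pi fun _ => mixture U (spread η Finset.univ)).real
        (fewVisits n (fun k => E (some k)) (fun k => spread η Finset.univ (some k)) j s) := by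
  have := Nonempty.intro j
  have hp := spread_mem_stdSimplex hη0 hη1 (Finset.univ_nonempty (α := κ))
  have := hU.isProbabilityMeasure_mixture hp
  have hcell (k : κ) : spread η Finset.univ (some k) = η / Fintype.card κ :=
    spread_some_of_mem η (Finset.mem_univ k)
  have hcard : (Fintype.card κ : ℝ) ≠ 0 := by simp
  convert one_sub_le_pi_fewVisits (n := n) (fun k => hU.measurableSet (some k))
    (fun k => hp.1 (some k)) hs j (mixture U (spread η Finset.univ)) using 4
  · simp only [hU.mixture_real hp.1, hcell, Finset.sum_const, Finset.card_univ, nsmul_eq_mul]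
    field_simp
  · rw [hU.mixture_real hp.1, hcell]

theorem exp_neg_log_div_sq_pow {m : ℝ} (hm : 0 < m) (hn : n ≠ 0) :
    (Real.exp (-(Real.log m / n)) ^ 2) ^ n = (m ^ 2)⁻¹ := by
  have hpow : Real.exp (-(Real.log m / n)) ^ n = m⁻¹ := by
    rw [← Real.exp_nat_mul, mul_neg, mul_div_cancel₀ _ (Nat.cast_ne_zero.2 hn), Real.exp_neg,
      Real.exp_log hm]
  rw [pow_right_comm, hpow, inv_pow]

theorem half_le_one_sub_mul {C m : ℝ} (hm : 1 ≤ m) (hn : n ≠ 0) (hC : Real.log m ≤ C * n)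
    (hlog : Real.log m ≤ Real.exp (-C) / 20 * m) {x : ℝ} (hx : x = Real.exp (-(Real.log m / n)))
    (hx1 : x < 1) :
    1 / 2 ≤ 1 - n * ((1 - x ^ 2) ^ 2 / (m * ((1 - x ^ 2) * x / 4)) + (1 - x ^ 2) / m) := by
  have hx0 : 0 < x := hx ▸ Real.exp_pos _
  have hn0 : (0 : ℝ) < n := by positivity
  have hη : 0 < 1 - x ^ 2 := by nlinarith
  have hCx : Real.exp (-C) ≤ x := by
    rw [hx, Real.exp_le_exp, neg_le_neg_iff, div_le_iff₀ hn0]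
    exact hC
  have hnη : n * (1 - x ^ 2) ≤ 2 * (x / 20 * m) := by
    calc n * (1 - x ^ 2) ≤ n * (2 * (Real.log m / n)) := by
          rw [hx]
          exact mul_le_mul_of_nonneg_left (one_sub_exp_neg_sq_le _) hn0.le
      _ = 2 * Real.log m := by field_simp
      _ ≤ 2 * (x / 20 * m) := by
          have : Real.exp (-C) / 20 * m ≤ x / 20 * m := by gcongr
          linarith
  have hsum : n * ((1 - x ^ 2) ^ 2 / (m * ((1 - x ^ 2) * x / 4)) + (1 - x ^ 2) / m) ≤
      5 / (x * m) * (n * (1 - x ^ 2)) := by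
    have : n * (1 - x ^ 2) * (1 / m) ≤ n * (1 - x ^ 2) * (1 / (x * m)) := by
      gcongr
      exact mul_le_of_le_one_left (by linarith) hx1.le
    calc _ = 4 / (x * m) * (n * (1 - x ^ 2)) + n * (1 - x ^ 2) * (1 / m) := by field_simp
      _ ≤ 4 / (x * m) * (n * (1 - x ^ 2)) + n * (1 - x ^ 2) * (1 / (x * m)) := by gcongr
      _ = _ := by ring
  have hhalf : 5 / (x * m) * (2 * (x / 20 * m)) = 1 / 2 := by
    field_simp
    norm_num
  have : 5 / (x * m) * (n * (1 - x ^ 2)) ≤ 5 / (x * m) * (2 * (x / 20 * m)) :=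
    mul_le_mul_of_nonneg_left hnη (by positivity)
  linarith

/- For few cells, all sample points fall into the common cell with a probability that is bounded
below; for many cells, the cells visited typically carry only a small part of the mass. -/
theorem IsCellFamily.exists_le_pi_fewVisits (C : ℝ) :
    ∃ c : ℝ, 0 < c ∧ ∀ {α κ : Type*} [MeasurableSpace α] [Fintype κ] [DecidableEq κ]
      {E : Option κ → Set α} {U : Option κ → Measure α} {n : ℕ} {x : ℝ}, IsCellFamily E U →
      2 ≤ Fintype.card κ → n ≠ 0 → Real.log (Fintype.card κ) ≤ C * n →
      x = Real.exp (-(Real.log (Fintype.card κ) / n)) → x < 1 → ∀ j : κ,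
      ∃ s, x ^ 2 + s ≤ x * (1 - (1 - x ^ 2) / Fintype.card κ) ∧
        c ≤ (Measure.pi fun _ => mixture U (spread (1 - x ^ 2) Finset.univ)).real
          (fewVisits n (fun k => E (some k))
            (fun k => spread (1 - x ^ 2) Finset.univ (some k)) j s) := by
  obtain ⟨N, hN⟩ := exists_forall_log_le_mul (show 0 < Real.exp (-C) / 20 by positivity)
  set m₀ := max N 4
  have hm₀ : (4 : ℝ) ≤ m₀ := by exact_mod_cast le_max_right N 4
  refine ⟨((m₀ : ℝ) ^ 2)⁻¹, by positivity, fun {α κ _ _ _ E U n x} hU hκ hn hC hx hx1 j => ?_⟩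
  have hx0 : 0 < x := hx ▸ Real.exp_pos _
  have hη : 0 < 1 - x ^ 2 := by nlinarith
  have := Nonempty.intro j
  have hcard : (2 : ℝ) ≤ Fintype.card κ := by exact_mod_cast hκ
  rcases le_total (Fintype.card κ) m₀ with hle | hge
  · refine ⟨0, by simpa using sq_le_mul_one_sub_div hx0.le hx1.le hcard, ?_⟩
    refine le_trans ?_ (hU.pow_le_pi_fewVisits (spread_mem_stdSimplex hη.le
      (sub_le_self 1 (sq_nonneg x)) Finset.univ_nonempty) _ j le_rfl)
    rw [spread_none, sub_sub_cancel, hx, exp_neg_log_div_sq_pow (by linarith) hn]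
    have : (Fintype.card κ : ℝ) ≤ m₀ := by exact_mod_cast hle
    gcongr
  · have hcard4 : (4 : ℝ) ≤ Fintype.card κ := by exact_mod_cast (le_max_right N 4).trans hge
    refine ⟨(1 - x ^ 2) * x / 4, sq_add_le_mul_one_sub_div hx0.le hx1.le hcard4, ?_⟩
    have hm₀half : ((m₀ : ℝ) ^ 2)⁻¹ ≤ 1 / 2 := by
      rw [one_div]
      exact inv_anti₀ two_pos (by nlinarith)
    exact hm₀half.trans <| (half_le_one_sub_mul (by linarith) hn hC
      (hN _ ((le_max_left N 4).trans hge)) hx hx1).trans <|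
        hU.one_sub_le_pi_fewVisits_spread hη.le (sub_le_self 1 (sq_nonneg x)) (by positivity) j

theorem IsCellFamily.exists_le_lintegral_klDiv_delete_spread (C : ℝ) :
    ∃ c : ℝ, 0 < c ∧ ∀ {α κ : Type*} [MeasurableSpace α] [Fintype κ] [DecidableEq κ]
      {E : Option κ → Set α} {U : Option κ → Measure α} {n : ℕ} {q : ℝ}, IsCellFamily E U →
      2 ≤ Fintype.card κ → n ≠ 0 → Real.log (Fintype.card κ) ≤ C * n → 0 < q →
      ∃ p ∈ stdSimplex ℝ (Option κ), (∀ k, p (some k) < 1) ∧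
        ∀ (Q : Kernel (Fin n → α) α) [IsMarkovKernel Q],
          ∃ k, ENNReal.ofReal (c * (Real.log (Fintype.card κ) / n) ^ q) ≤
            ∫⁻ D, klDiv (Q D) (mixture U (deleteCell p (some k))) ^ q
              ∂Measure.pi fun _ => mixture U (deleteCell p (some k)) := by
  obtain ⟨c, hc, hfew⟩ := IsCellFamily.exists_le_pi_fewVisits C
  refine ⟨c, hc, fun {α κ _ _ _ E U n q} hU hκ hn hC hq => ?_⟩
  have hcard : (2 : ℝ) ≤ Fintype.card κ := by exact_mod_cast hκ
  have hL : 0 < Real.log (Fintype.card κ) / n :=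
    div_pos (Real.log_pos (by linarith)) (by positivity)
  obtain ⟨x, hx⟩ := exists_eq (a' := Real.exp (-(Real.log (Fintype.card κ) / n)))
  have hx0 : 0 < x := hx ▸ Real.exp_pos _
  have hx1 : x < 1 := by
    rw [hx, Real.exp_lt_one_iff]
    linarith
  have hη : 0 < 1 - x ^ 2 := by nlinarith
  have := Fintype.card_pos_iff.1 (two_pos.trans_le hκ)
  have hp := spread_mem_stdSimplex hη.le (sub_le_self 1 (sq_nonneg x))
    (Finset.univ_nonempty (α := κ))
  have hcell (k : κ) : spread (1 - x ^ 2) Finset.univ (some k) = (1 - x ^ 2) / Fintype.card κ :=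
    spread_some_of_mem _ (Finset.mem_univ k)
  have hp1 (k : κ) : spread (1 - x ^ 2) Finset.univ (some k) < 1 := by
    rw [hcell, div_lt_one (by linarith)]
    nlinarith
  refine ⟨_, hp, hp1, fun Q _ => ?_⟩
  obtain ⟨j⟩ := this
  obtain ⟨s, hs, hprob⟩ := hfew hU hκ hn hC hx hx1 j
  obtain ⟨k, hk⟩ := hU.exists_le_lintegral_klDiv_deleteCell (s := s) (j := j) hp hp1 hq hx0 hx1.le
    (by rwa [hcell, spread_none, sub_sub_cancel]) Q
  refine ⟨k, (ENNReal.ofReal_le_ofReal ?_).trans hk⟩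
  have hlog : Real.log (Fintype.card κ) / n = -Real.log x := by rw [hx, Real.log_exp, neg_neg]
  rw [hlog, mul_comm c]
  exact mul_le_mul_of_nonneg_left hprob (Real.rpow_nonneg (hlog ▸ hL.le) q)

end UniformDeletion

section CellDensity

variable {d : ℕ}

theorem exists_cells (hd : 1 ≤ d) (ι : Type*) [Finite ι] {v : ℝ} (hv : 0 < v) :
    ∃ E : ι → Set (EuclideanSpace ℝ (Fin d)), (∀ i, MeasurableSet (E i)) ∧
      Pairwise (Disjoint on E) ∧ ∀ i, volume.real (E i) = v := by
  obtain ⟨N, ⟨e⟩⟩ := Finite.exists_equiv_fin ι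
  let k₀ : Fin d := ⟨0, hd⟩
  let side (i : ι) : Fin d → Set ℝ :=
    update (fun _ => Set.Ico 0 1) k₀ (Set.Ico ((e i : ℕ) * v) (((e i : ℕ) + 1) * v))
  have hside (i : ι) : side i k₀ = Set.Ico ((e i : ℕ) * v) (((e i : ℕ) + 1) * v) := update_self ..
  have hmeas (i : ι) : MeasurableSet (Set.univ.pi (side i)) := by
    refine MeasurableSet.univ_pi fun k => ?_
    obtain rfl | hk := eq_or_ne k k₀
    · exact hside i ▸ measurableSet_Ico
    · simp [side, hk]
  have hofLp := PiLp.volume_preserving_ofLp (Fin d)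
  refine ⟨fun i => WithLp.ofLp ⁻¹' Set.univ.pi (side i), fun i => hofLp.measurable (hmeas i),
    fun i j hij => ?_, fun i => ?_⟩
  · refine Set.disjoint_left.2 fun x hxi hxj => hij (e.injective (Fin.ext ?_))
    obtain ⟨hi, hi'⟩ : _ ∈ Set.Ico _ _ := hside i ▸ hxi k₀ (Set.mem_univ _)
    obtain ⟨hj, hj'⟩ : _ ∈ Set.Ico _ _ := hside j ▸ hxj k₀ (Set.mem_univ _)
    have hlt : ((e i : ℕ) : ℝ) < (e j : ℕ) + 1 := lt_of_mul_lt_mul_right (hi.trans_lt hj') hv.le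
    have hgt : ((e j : ℕ) : ℝ) < (e i : ℕ) + 1 := lt_of_mul_lt_mul_right (hj.trans_lt hi') hv.le
    norm_cast at hlt hgt
    omega
  · have hother : ∏ k ∈ Finset.univ.erase k₀, volume (side i k) = 1 :=
      Finset.prod_eq_one fun k hk => by simp [side, Finset.ne_of_mem_erase hk]
    rw [measureReal_def, hofLp.measure_preimage (hmeas i).nullMeasurableSet, volume_pi_pi,
      ← Finset.mul_prod_erase _ _ (Finset.mem_univ k₀), hother, mul_one, hside, Real.volume_Ico,
      ← sub_mul, add_sub_cancel_left, one_mul, ENNReal.toReal_ofReal hv.le]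

variable {ι : Type*} [Fintype ι] {E : ι → Set (EuclideanSpace ℝ (Fin d))} {p : ι → ℝ}

/-- The density of the probability distribution which gives mass `p i` to the cell `E i`,
distributed uniformly over that cell. -/
noncomputable def cellDensity (E : ι → Set (EuclideanSpace ℝ (Fin d))) (p : ι → ℝ) :
    EuclideanSpace ℝ (Fin d) → ℝ :=
  stepFun E fun i => p i / volume.real (E i)

theorem law_cellDensity (hEm : ∀ i, MeasurableSet (E i)) (hE0 : ∀ i, volume.real (E i) ≠ 0)
    (hp : ∀ i, 0 ≤ p i) : law (cellDensity E p) = mixture (fun i => volume[|E i]) p :=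
  (mixture_cond hEm hE0 hp).symm

theorem isDensity_cellDensity (hEm : ∀ i, MeasurableSet (E i)) (hE : Pairwise (Disjoint on E))
    (hE0 : ∀ i, volume.real (E i) ≠ 0) (hp : p ∈ stdSimplex ℝ ι) :
    IsDensity (cellDensity E p) where
  measurable := measurable_stepFun hEm
  nonneg := stepFun_nonneg fun i => div_nonneg (hp.1 i) measureReal_nonneg
  lintegral_eq_one := by
    have := (isCellFamily_cond hEm hE hE0).isProbabilityMeasure_mixture hp
    rw [← setLIntegral_univ, ← withDensity_apply _ MeasurableSet.univ]
    change law (cellDensity E p) Set.univ = 1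
    rw [law_cellDensity hEm hE0 hp.1, measure_univ]

theorem cellDensity_mem_boundedDensities (hEm : ∀ i, MeasurableSet (E i))
    (hE : Pairwise (Disjoint on E)) {A : ℝ} (hA : 0 < A) (hEA : ∀ i, volume.real (E i) = A⁻¹)
    (hp : p ∈ stdSimplex ℝ ι) : cellDensity E p ∈ boundedDensities d A := by
  refine ⟨isDensity_cellDensity hEm hE (fun i => (hEA i).trans_ne (inv_ne_zero hA.ne')) hp,
    fun x => ?_⟩
  by_cases hx : ∃ i, x ∈ E i
  · obtain ⟨i, hi⟩ := hx
    rw [cellDensity, stepFun_of_mem hE hi, hEA, div_inv_eq_mul]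
    exact mul_le_of_le_one_left hA.le (mem_Icc_of_mem_stdSimplex hp i).2
  · exact (stepFun_of_notMem (not_exists.1 hx)).trans_le hA.le

end CellDensity

section Estimator

variable {d n M : ℕ} {A : ℝ} {f : EuclideanSpace ℝ (Fin d) → ℝ}
  {fhat : (Fin n → EuclideanSpace ℝ (Fin d)) → EuclideanSpace ℝ (Fin d) → ℝ}
  {loss : (EuclideanSpace ℝ (Fin d) → ℝ) → (EuclideanSpace ℝ (Fin d) → ℝ) → ℝ≥0∞}

theorem IsDensity.isProbabilityMeasure_law (hf : IsDensity f) : IsProbabilityMeasure (law f) := by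
  constructor
  rw [law, withDensity_apply _ MeasurableSet.univ, setLIntegral_univ, hf.lintegral_eq_one]

/-- The Markov kernel that maps a sample to the distribution predicted by the estimator. -/
noncomputable def IsEstimator.kernel (hf : IsEstimator n fhat) :
    Kernel (Fin n → EuclideanSpace ℝ (Fin d)) (EuclideanSpace ℝ (Fin d)) where
  toFun D := law (fhat D)
  measurable' := by
    refine Measure.measurable_of_measurable_coe _ fun S hS => ?_
    simp only [law, withDensity_apply _ hS]
    exact hf.measurable.ennreal_ofReal.lintegral_prod_right'

theorem IsEstimator.isMarkovKernel_kernel (hf : IsEstimator n fhat) : IsMarkovKernel hf.kernel :=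
  ⟨fun D => (hf.isDensity D).isProbabilityMeasure_law⟩

theorem le_minimaxExcess {fs : Fin M → EuclideanSpace ℝ (Fin d) → ℝ}
    (hfs : ∀ j, fs j ∈ boundedDensities d A) {v : ℝ} (hv : 0 ≤ v)
    (h : ∀ fhat ∈ estimators d n, ∃ f ∈ boundedDensities d A, ∃ j, loss f (fs j) ≠ ∞ ∧
      ENNReal.ofReal v + loss f (fs j) ≤ expect f fun D => loss f (fhat D)) :
    (v : EReal) ≤ minimaxExcess d n M A loss := by
  refine le_iSup_of_le (fun j => ⟨fs j, hfs j⟩) <| le_iInf fun fhat => ?_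
  obtain ⟨f, hf, j, hfin, hle⟩ := h fhat.1 fhat.2
  have hmin : ⨅ j, loss f (fs j) ≠ ∞ := ne_top_of_le_ne_top hfin (iInf_le _ j)
  refine le_iSup_of_le ⟨f, hf⟩ ?_
  rw [excessRisk, EReal.le_sub_iff_add_le (.inl (by simp)) (.inl (by simpa using hmin))]
  calc (v : EReal) + ((⨅ j, loss f (fs j) : ℝ≥0∞) : EReal)
      = ((ENNReal.ofReal v + ⨅ j, loss f (fs j) : ℝ≥0∞) : EReal) := by
        rw [EReal.coe_ennreal_add, EReal.coe_ennreal_ofReal, max_eq_left hv]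
    _ ≤ (expect f fun D => loss f (fhat.1 D) : ℝ≥0∞) :=
        EReal.coe_ennreal_le_coe_ennreal_iff.2 (le_trans (by gcongr; exact iInf_le _ j) hle)

end Estimator

section MinimaxBounds

variable {d n M : ℕ} {A q η ρ v : ℝ}

theorem le_minimaxExcess_KL_of_add_le (hA : 0 < A) (hd : 1 ≤ d) (hM : M ≠ 0) {B : ℕ} (hB : B ≠ 0)
    (hq : 0 ≤ q) (hη0 : 0 < η) (hη1 : η < 1) (hρ : 1 ≤ ρ) (hv : 0 ≤ v)
    (h : v + (η * Real.log B) ^ q ≤ (1 - η) ^ n * (1 - ρ / (M * B : ℕ)) * (η * Real.log ρ) ^ q) :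
    (v : EReal) ≤ minimaxExcess d n M A fun f g => KL f g ^ q := by
  have := NeZero.mk hM
  have := NeZero.mk hB
  obtain ⟨E, hEm, hE, hEA⟩ := exists_cells hd (Option (Fin M × Fin B)) (inv_pos.2 hA)
  have hE0 (i) : volume.real (E i) ≠ 0 := (hEA i).trans_ne (inv_ne_zero hA.ne')
  have hU := isCellFamily_cond hEm hE hE0
  have hspread {S : Finset (Fin M × Fin B)} (hS : S.Nonempty) :=
    spread_mem_stdSimplex hη0.le hη1.le hS
  have hmem {S : Finset (Fin M × Fin B)} (hS : S.Nonempty) :=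
    cellDensity_mem_boundedDensities hEm hE hA hEA (hspread hS)
  let block (j : Fin M) : Finset (Fin M × Fin B) := {j} ×ˢ Finset.univ
  have hblock (j : Fin M) : (block j).Nonempty :=
    Finset.singleton_nonempty j |>.product Finset.univ_nonempty
  have hlog : 0 ≤ η * Real.log B := mul_nonneg hη0.le (Real.log_natCast_nonneg B)
  refine le_minimaxExcess (fs := fun j => cellDensity E (spread η (block j)))
    (fun j => hmem (hblock j)) hv fun fhat hfhat => ?_
  have := IsEstimator.isMarkovKernel_kernel hfhat
  obtain ⟨t, ht⟩ := hU.exists_le_lintegral_klDiv_spike hη0.le hη1.le hρ hq hfhat.kernel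
  have hlaw {S : Finset (Fin M × Fin B)} (hS : S.Nonempty) :=
    law_cellDensity hEm hE0 (hspread hS).1
  have hsing := Finset.singleton_nonempty t
  have hloss : KL (cellDensity E (spread η {t})) (cellDensity E (spread η (block t.1))) ^ q =
      ENNReal.ofReal ((η * Real.log B) ^ q) := by
    rw [KL, hlaw hsing, hlaw (hblock _), hU.klDiv_spread hη0 hη1 hsing (by simp [block]),
      ENNReal.ofReal_rpow_of_nonneg _ hq]
    · simp [block]
    · simpa [block] using hlog
  refine ⟨_, hmem hsing, t.1, by simp [hloss], ?_⟩
  rw [hloss, ← ENNReal.ofReal_add hv (Real.rpow_nonneg hlog q)]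
  simp only [expect, KL, hlaw hsing]
  refine le_trans (ENNReal.ofReal_le_ofReal ?_) ht
  simpa using h

theorem exists_le_minimaxExcess_KL_swap (C : ℝ) :
    ∃ c : ℝ, 0 < c ∧ ∀ {A : ℝ}, 0 < A → ∀ {d M n : ℕ}, 1 ≤ d → 2 ≤ M → n ≠ 0 →
      Real.log M ≤ C * n → ∀ {q : ℝ}, 0 < q →
        ((c * (Real.log M / n) ^ q : ℝ) : EReal) ≤
          minimaxExcess d n M A fun f g => KL g f ^ q := by
  obtain ⟨c, hc, hdel⟩ := IsCellFamily.exists_le_lintegral_klDiv_delete_spread C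
  refine ⟨c, hc, fun {A} hA {d M n} hd hM hn hC {q} hq => ?_⟩
  obtain ⟨E, hEm, hE, hEA⟩ := exists_cells hd (Option (Fin M)) (inv_pos.2 hA)
  have hE0 (i) : volume.real (E i) ≠ 0 := (hEA i).trans_ne (inv_ne_zero hA.ne')
  obtain ⟨p, hp, hp1, hpQ⟩ := hdel (κ := Fin M) (n := n) (isCellFamily_cond hEm hE hE0)
    (by simpa using hM) hn (by simpa using hC) hq
  have hdelete (k : Fin M) := deleteCell_mem_stdSimplex hp (hp1 k)
  have hmem (k : Fin M) := cellDensity_mem_boundedDensities hEm hE hA hEA (hdelete k)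
  refine le_minimaxExcess hmem (mul_nonneg hc.le (by positivity)) fun fhat hfhat => ?_
  have := IsEstimator.isMarkovKernel_kernel hfhat
  obtain ⟨k, hk⟩ := hpQ hfhat.kernel
  have := (hmem k).1.isProbabilityMeasure_law
  have hloss : KL (cellDensity E (deleteCell p (some k)))
      (cellDensity E (deleteCell p (some k))) ^ q = 0 := by
    rw [KL, klDiv_self, ENNReal.zero_rpow_of_pos hq]
  refine ⟨_, hmem k, k, by simp [hloss], ?_⟩
  rw [hloss, add_zero]
  simp only [expect, KL, law_cellDensity hEm hE0 (hdelete k).1]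
  rw [Fintype.card_fin] at hk
  exact hk

theorem one_seventh_le_mul (hn : n ≠ 0) (hM : 2 ≤ M) :
    1 / 7 ≤ (1 - 1 / (2 * n : ℝ)) ^ n * (1 - 1 / √M) := by
  have hhalf : 1 / 2 ≤ (1 - 1 / (2 * n : ℝ)) ^ n := by
    have hn1 : (1 : ℝ) ≤ n := by exact_mod_cast Nat.one_le_iff_ne_zero.2 hn
    have hle : 1 / (2 * n : ℝ) ≤ 1 := (div_le_one (by positivity)).2 (by linarith)
    calc (1 / 2 : ℝ) = 1 + n * -(1 / (2 * n)) := by field_simp; norm_num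
      _ ≤ (1 + -(1 / (2 * n : ℝ))) ^ n := one_add_mul_le_pow (by linarith) n
      _ = _ := by rw [← sub_eq_add_neg]
  have hsqrt : 7 / 5 ≤ √(M : ℝ) := by
    have : (2 : ℝ) ≤ M := by exact_mod_cast hM
    exact Real.le_sqrt_of_sq_le (by linarith)
  have hinv : 2 / 7 ≤ 1 - 1 / √(M : ℝ) := by
    have := one_div_le_one_div_of_le (by norm_num) hsqrt
    linarith
  calc (1 / 7 : ℝ) = 1 / 2 * (2 / 7) := by norm_num
    _ ≤ _ := by gcongr

theorem mul_rpow_add_zero_rpow_le {L : ℝ} (hL : 0 ≤ L) (hq0 : 0 < q) (hq : q ≤ 12) :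
    (1 / 4) ^ 12 / 7 * L ^ q + 0 ^ q ≤ 1 / 7 * (L / 4) ^ q := by
  have hquarter : (1 / 4 : ℝ) ^ 12 ≤ (1 / 4) ^ q := by
    rw [← Real.rpow_natCast]
    exact Real.rpow_le_rpow_of_exponent_ge (by norm_num) (by norm_num) (by exact_mod_cast hq)
  have := mul_le_mul_of_nonneg_right hquarter (Real.rpow_nonneg hL q)
  rw [Real.zero_rpow hq0.ne', div_eq_mul_one_div L, mul_comm L,
    Real.mul_rpow (by norm_num) hL]
  linarith

theorem mul_rpow_add_rpow_le {L : ℝ} (hL : 0 ≤ L) (hq : 12 ≤ q) :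
    (1 / 4) ^ 12 / 7 * L ^ q + L ^ q ≤ 1 / 7 * (5 / 4 * L) ^ q := by
  have hgrowth : (14 : ℝ) ≤ (5 / 4) ^ q := by
    calc (14 : ℝ) ≤ (5 / 4) ^ (12 : ℝ) := by
          rw [show (12 : ℝ) = (12 : ℕ) by norm_num, Real.rpow_natCast]
          norm_num
      _ ≤ (5 / 4) ^ q := Real.rpow_le_rpow_of_exponent_le (by norm_num) hq
  have := mul_le_mul_of_nonneg_right hgrowth (Real.rpow_nonneg hL q)
  have := Real.rpow_nonneg hL q
  rw [Real.mul_rpow (by norm_num) hL]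
  linarith

/- With blocks of a single cell the best candidate is exact. With blocks of `M ^ 2` cells it is not,
but the estimator loses `5 / 4` times as much, and `(5 / 4) ^ q` outweighs all other factors when
`q` is large: this makes the constant independent of `q`. -/
theorem le_minimaxExcess_KL (hA : 0 < A) (hd : 1 ≤ d) (hM : 2 ≤ M) (hn : n ≠ 0) (hq : 0 < q) :
    (((1 / 4) ^ 12 / 7 * (Real.log M / n) ^ q : ℝ) : EReal) ≤
      minimaxExcess d n M A fun f g => KL f g ^ q := by
  have hM1 : (1 : ℝ) ≤ M := by exact_mod_cast (one_le_two.trans hM)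
  have hsqrt : 1 ≤ √(M : ℝ) := Real.one_le_sqrt.2 hM1
  have hL : 0 ≤ Real.log M / n := by positivity
  have hη0 : 0 < 1 / (2 * n : ℝ) := by positivity
  have hη1 : 1 / (2 * n : ℝ) < 1 := by
    have : (1 : ℝ) ≤ n := by exact_mod_cast Nat.one_le_iff_ne_zero.2 hn
    exact (div_lt_one (by positivity)).2 (by linarith)
  have hfactor := one_seventh_le_mul hn hM
  rcases le_total q 12 with hq12 | hq12
  · refine le_minimaxExcess_KL_of_add_le (ρ := √M) hA hd (by omega) one_ne_zero hq.le hη0 hη1 hsqrt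
      (by positivity) ?_
    have hdiv : √(M : ℝ) / (M * 1 : ℕ) = 1 / √M := by
      rw [mul_one, Real.sqrt_div_self']
    have hspike : 1 / (2 * n : ℝ) * Real.log √M = Real.log M / n / 4 := by
      rw [Real.log_sqrt (by positivity)]
      ring
    rw [hdiv, hspike, Nat.cast_one, Real.log_one, mul_zero]
    exact (mul_rpow_add_zero_rpow_le hL hq hq12).trans (by gcongr)
  · refine le_minimaxExcess_KL_of_add_le (ρ := M ^ 2 * √M) hA hd (by omega) (B := M ^ 2)
      (by positivity) hq.le hη0 hη1 (one_le_mul_of_one_le_of_one_le (one_le_pow₀ hM1) hsqrt)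
      (by positivity) ?_
    have hdiv : M ^ 2 * √(M : ℝ) / (M * M ^ 2 : ℕ) = 1 / √M := by
      rw [← Real.sqrt_div_self']
      push_cast
      field_simp
    have hblock : 1 / (2 * n : ℝ) * Real.log (M ^ 2 : ℕ) = Real.log M / n := by
      rw [Nat.cast_pow, Real.log_pow]
      push_cast
      ring
    have hspike : 1 / (2 * n : ℝ) * Real.log (M ^ 2 * √M) = 5 / 4 * (Real.log M / n) := by
      rw [Real.log_mul (by positivity) (by positivity), Real.log_sqrt (by positivity),
        Real.log_pow]
      push_cast
      ring
    rw [hdiv, hblock, hspike]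
    exact (mul_rpow_add_rpow_le hL hq12).trans (by gcongr)

end MinimaxBounds

end DensityAggregation

theorem mainTheorem3_general (C : ℝ) :
    ∃ c : ℝ, 0 < c ∧
      ∀ (A : ℝ), 0 < A → ∀ (d : ℕ), 1 ≤ d → ∀ (M : ℕ), 2 ≤ M → ∀ (q : ℝ), 0 < q →
        ∀ (n : ℕ), Real.log (M : ℝ) ≤ C * (n : ℝ) →
          ((c * (Real.log (M : ℝ) / (n : ℝ)) ^ q : ℝ) : EReal) ≤
              DensityAggregation.minimaxExcess d n M A
                (fun f g => DensityAggregation.KL f g ^ q) ∧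
          ((c * (Real.log (M : ℝ) / (n : ℝ)) ^ q : ℝ) : EReal) ≤
              DensityAggregation.minimaxExcess d n M A
                (fun f g => DensityAggregation.KL g f ^ q) := by
  obtain ⟨c, hc, hswap⟩ := DensityAggregation.exists_le_minimaxExcess_KL_swap C
  refine ⟨min ((1 / 4) ^ 12 / 7) c, lt_min (by norm_num) hc, fun A hA d hd M hM q hq n hC => ?_⟩
  have hlog : 0 < Real.log M := Real.log_pos (by exact_mod_cast hM)
  have hn : n ≠ 0 := by
    rintro rfl
    rw [Nat.cast_zero, mul_zero] at hC
    exact hC.not_gt hlog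
  have hrate : 0 ≤ (Real.log M / n) ^ q := by positivity
  have hmono {a b : ℝ} (h : a ≤ b) :
      ((a * (Real.log M / n) ^ q : ℝ) : EReal) ≤ ((b * (Real.log M / n) ^ q : ℝ) : EReal) :=
    EReal.coe_le_coe_iff.2 (mul_le_mul_of_nonneg_right h hrate)
  exact ⟨(hmono (min_le_left _ _)).trans (DensityAggregation.le_minimaxExcess_KL hA hd hM hn hq),
    (hmono (min_le_right _ _)).trans (hswap hA hd hM hn hC hq)⟩

theorem mainTheorem3 (A : ℝ) (hA : 1 < A) :
    ∃ c : ℝ, 0 < c ∧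
      ∀ (d : ℕ), 1 ≤ d → ∀ (M : ℕ), 2 ≤ M → ∀ (q : ℝ), 0 < q →
        ∀ (n : ℕ), Real.log (M : ℝ) ≤ 16 * (min 1 (A - 1)) ^ 2 * (n : ℝ) →
          ((c * (Real.log (M : ℝ) / (n : ℝ)) ^ q : ℝ) : EReal) ≤
              DensityAggregation.minimaxExcess d n M A
                (fun f g => DensityAggregation.KL f g ^ q) ∧
          ((c * (Real.log (M : ℝ) / (n : ℝ)) ^ q : ℝ) : EReal) ≤
              DensityAggregation.minimaxExcess d n M A
                (fun f g => DensityAggregation.KL g f ^ q) := by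
  obtain ⟨c, hc, h⟩ := mainTheorem3_general (16 * (min 1 (A - 1)) ^ 2)
  exact ⟨c, hc, h A (one_pos.trans hA)⟩
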